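/- Let $A$ be a group, let $C, D \leq A$ be subgroups with $C$ infinite cyclic, and let $\varphi : C \to D$ be an isomorphism. Let $G = A\ast_C$ be the corresponding HNN extension, $G = \langle A, t \mid tct^{-1} = \varphi(c)\ (c \in C)\rangle$. Suppose that $G$ has the unique root property: for all $x, y \in G$ and every positive integer $n$, $x^n = y^n$ implies $x = y$. Then the abstract commensurator $\mathrm{Comm}(G)$ is not finitely generated. Here $\mathrm{Comm}(G)$ is the group of equivalence classes of isomorphisms $\alpha : G_1 \to G_1'$ between finite-index subgroups of $G$, where two such isomorphisms are equivalent if they are both defined, and agree, on some finite-index subgroup of $G$, and where the product of the classes of $\alpha : G_1 \to G_1'$ and $\beta : G_2 \to G_2'$ is the class of the isomorphism $\alpha^{-1}(G_1' \cap G_2) \to \beta(G_1' \cap G_2)$ obtained by applying first $\alpha$ and then $\beta$. -/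

import Mathlib

/-- The unique root property of a group: `x ^ n = y ^ n` with `n` a positive integer
implies `x = y`. -/
def UniqueRootProperty (G : Type*) [Group G] : Prop :=
  ∀ (x y : G) (n : ℕ), 0 < n → x ^ n = y ^ n → x = y

/-- An isomorphism `source ≃* target` between two subgroups of finite index of `G`. -/
structure PartialIso (G : Type*) [Group G] where
  source : Subgroup G
  target : Subgroup G
  source_finiteIndex : source.FiniteIndex
  target_finiteIndex : target.FiniteIndex
  iso : source ≃* target

namespace PartialIso

variable {G : Type*} [Group G]

/-- The preimage `{x ∈ source | α x ∈ K}` of a subgroup `K` of `G`. -/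
def preimage (α : PartialIso G) (K : Subgroup G) : Subgroup G :=
  (K.comap (α.target.subtype.comp α.iso.toMonoidHom)).map α.source.subtype

theorem mem_preimage {α : PartialIso G} {K : Subgroup G} {x : G} :
    x ∈ α.preimage K ↔ ∃ h : x ∈ α.source, (α.iso ⟨x, h⟩ : G) ∈ K := by
  simp [preimage]

theorem preimage_le (α : PartialIso G) (K : Subgroup G) : α.preimage K ≤ α.source :=
  fun _ hx => (mem_preimage.1 hx).1

theorem preimage_finiteIndex (α : PartialIso G) (K : Subgroup G) (hK : K.FiniteIndex) :
    (α.preimage K).FiniteIndex := by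
  have hs := α.source_finiteIndex
  refine ⟨?_⟩
  rw [preimage, Subgroup.index_map_subtype]
  refine mul_ne_zero ?_ hs.index_ne_zero
  rw [Subgroup.index_comap]
  exact fun h => hK.index_ne_zero (Subgroup.index_eq_zero_of_relIndex_eq_zero h)

/-- The identity of `G`. -/
def refl (G : Type*) [Group G] : PartialIso G where
  source := ⊤
  target := ⊤
  source_finiteIndex := inferInstance
  target_finiteIndex := inferInstance
  iso := MulEquiv.refl _

/-- The inverse isomorphism. -/
def symm (α : PartialIso G) : PartialIso G where
  source := α.target
  target := α.source
  source_finiteIndex := α.target_finiteIndex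
  target_finiteIndex := α.source_finiteIndex
  iso := α.iso.symm

theorem mem_preimage_symm {α : PartialIso G} {K : Subgroup G} {y : G} :
    y ∈ α.symm.preimage K ↔ ∃ h : y ∈ α.target, (α.iso.symm ⟨y, h⟩ : G) ∈ K :=
  mem_preimage

/-- The product `αβ` (first `α`, then `β`), an isomorphism from
`α⁻¹(α.target ∩ β.source)` onto `β(α.target ∩ β.source)`, where the latter
is the preimage of `α.target` under `β⁻¹`. -/
def mul (α β : PartialIso G) : PartialIso G where
  source := α.preimage β.source
  target := β.symm.preimage α.target
  source_finiteIndex := α.preimage_finiteIndex _ β.source_finiteIndex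
  target_finiteIndex := β.symm.preimage_finiteIndex _ α.target_finiteIndex
  iso :=
    { toFun := fun x =>
        ⟨β.iso ⟨α.iso ⟨x, (mem_preimage.1 x.2).1⟩, (mem_preimage.1 x.2).2⟩,
          mem_preimage_symm.2 ⟨Subtype.property _, by simp⟩⟩
      invFun := fun y =>
        ⟨α.iso.symm ⟨β.iso.symm ⟨y, (mem_preimage_symm.1 y.2).1⟩,
            (mem_preimage_symm.1 y.2).2⟩,
          mem_preimage.2 ⟨Subtype.property _, by simp⟩⟩
      left_inv := fun x => by simp
      right_inv := fun y => by simp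
      map_mul' := fun x y => by
        apply Subtype.ext
        have h₁ := map_mul α.iso ⟨x, (mem_preimage.1 x.2).1⟩ ⟨y, (mem_preimage.1 y.2).1⟩
        have h₂ := map_mul β.iso
          ⟨α.iso ⟨x, (mem_preimage.1 x.2).1⟩, (mem_preimage.1 x.2).2⟩
          ⟨α.iso ⟨y, (mem_preimage.1 y.2).1⟩, (mem_preimage.1 y.2).2⟩
        refine Eq.trans ?_ (congrArg (fun z : β.target => (z : G)) h₂)
        refine congrArg (fun z => (β.iso z : G)) (Subtype.ext ?_)
        exact congrArg (fun z : α.target => (z : G)) h₁ }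

theorem mul_iso_apply (α β : PartialIso G) (x : G) (hx : x ∈ (α.mul β).source)
    (h₁ : x ∈ α.source) (h₂ : (α.iso ⟨x, h₁⟩ : G) ∈ β.source) :
    ((α.mul β).iso ⟨x, hx⟩ : G) = β.iso ⟨α.iso ⟨x, h₁⟩, h₂⟩ := rfl

/-- Two isomorphisms are equivalent if both are defined, and agree, on some subgroup of
finite index of `G`. -/
def Equivalent (α β : PartialIso G) : Prop :=
  ∃ H : Subgroup G, H.FiniteIndex ∧ ∃ (hα : H ≤ α.source) (hβ : H ≤ β.source),
    ∀ (x : G) (hx : x ∈ H), (α.iso ⟨x, hα hx⟩ : G) = β.iso ⟨x, hβ hx⟩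

instance setoid (G : Type*) [Group G] : Setoid (PartialIso G) where
  r := Equivalent
  iseqv :=
    { refl := fun α => ⟨α.source, α.source_finiteIndex, le_rfl, le_rfl, fun _ _ => rfl⟩
      symm := fun ⟨H, hH, hα, hβ, h⟩ => ⟨H, hH, hβ, hα, fun x hx => (h x hx).symm⟩
      trans := fun ⟨H, _, hα, _, h⟩ ⟨K, _, _, hγ, k⟩ =>
        ⟨H ⊓ K, inferInstance, inf_le_left.trans hα, inf_le_right.trans hγ,
          fun x hx => (h x hx.1).trans (k x hx.2)⟩ }

theorem mul_equivalent {α α' β β' : PartialIso G} (hα : Equivalent α α')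
    (hβ : Equivalent β β') : Equivalent (α.mul β) (α'.mul β') := by
  obtain ⟨H, hH, h1, h2, h⟩ := hα
  obtain ⟨K, hK, k1, k2, k⟩ := hβ
  have hP := α.preimage_finiteIndex K hK
  refine ⟨H ⊓ α.preimage K, inferInstance, ?_, ?_, ?_⟩
  · rintro x ⟨-, hx⟩
    obtain ⟨hs, hx⟩ := mem_preimage.1 hx
    exact mem_preimage.2 ⟨hs, k1 hx⟩
  · rintro x ⟨hxH, hx⟩
    obtain ⟨hs, hx⟩ := mem_preimage.1 hx
    exact mem_preimage.2 ⟨h2 hxH, by rw [← h x hxH]; exact k2 hx⟩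
  · rintro x ⟨hxH, hx⟩
    obtain ⟨hs, hx⟩ := mem_preimage.1 hx
    have e' : (α'.iso ⟨x, h2 hxH⟩ : G) ∈ K := by rw [← h x hxH]; exact hx
    rw [mul_iso_apply α β x _ hs (k1 hx), mul_iso_apply α' β' x _ (h2 hxH) (k2 e'), k _ hx]
    congr 3
    exact h x hxH

theorem symm_equivalent {α β : PartialIso G} (h : Equivalent α β) :
    Equivalent α.symm β.symm := by
  obtain ⟨H, hH, h1, h2, h⟩ := h
  have key : ∀ (y : G) (hs : y ∈ α.target) (hy : (α.iso.symm ⟨y, hs⟩ : G) ∈ H),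
      (β.iso ⟨α.iso.symm ⟨y, hs⟩, h2 hy⟩ : G) = y := by
    intro y hs hy
    rw [← h _ hy]
    simp
  have key' : ∀ (y : G) (hs : y ∈ α.target) (hy : (α.iso.symm ⟨y, hs⟩ : G) ∈ H),
      y ∈ β.target := fun y hs hy => by
    have := Subtype.property (β.iso ⟨α.iso.symm ⟨y, hs⟩, h2 hy⟩)
    rwa [key y hs hy] at this
  refine ⟨α.symm.preimage H, α.symm.preimage_finiteIndex H hH, preimage_le _ _, ?_, ?_⟩
  · intro y hy
    obtain ⟨hs, hy⟩ := mem_preimage_symm.1 hy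
    exact key' y hs hy
  · intro y hy
    obtain ⟨hs, hy⟩ := mem_preimage_symm.1 hy
    change (α.iso.symm ⟨y, hs⟩ : G) = β.iso.symm ⟨y, key' y hs hy⟩
    have e : (⟨α.iso.symm ⟨y, hs⟩, h2 hy⟩ : β.source) = β.iso.symm ⟨y, key' y hs hy⟩ := by
      rw [MulEquiv.eq_symm_apply]
      exact Subtype.ext (key y hs hy)
    rw [← e]

end PartialIso

/-- The abstract commensurator of `G`: the isomorphisms between subgroups of finite index,
modulo equality on a subgroup of finite index. -/
def Comm (G : Type*) [Group G] : Type _ := Quotient (PartialIso.setoid G)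

namespace Comm

variable {G : Type*} [Group G]

/-- The class in `Comm G` of an isomorphism between subgroups of finite index. -/
def mk (α : PartialIso G) : Comm G := Quotient.mk (PartialIso.setoid G) α

/-- The group structure of the abstract commensurator, with `[α] * [β] = [αβ]`. -/
instance : Group (Comm G) where
  mul := Quotient.map₂ PartialIso.mul
    (fun _ _ hα _ _ hβ => PartialIso.mul_equivalent hα hβ)
  one := mk (PartialIso.refl G)
  inv := Quotient.map PartialIso.symm (fun _ _ h => PartialIso.symm_equivalent h)
  mul_assoc := by
    rintro ⟨α⟩ ⟨β⟩ ⟨γ⟩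
    refine Quotient.sound ⟨((α.mul β).mul γ).source, ((α.mul β).mul γ).source_finiteIndex,
      le_rfl, ?_, fun _ _ => rfl⟩
    intro x hx
    obtain ⟨hx, h3⟩ := PartialIso.mem_preimage.1 hx
    obtain ⟨h1, h2⟩ := PartialIso.mem_preimage.1 hx
    exact PartialIso.mem_preimage.2 ⟨h1, PartialIso.mem_preimage.2 ⟨h2, h3⟩⟩
  one_mul := by
    rintro ⟨α⟩
    exact Quotient.sound ⟨α.source, α.source_finiteIndex,
      fun x hx => PartialIso.mem_preimage.2 ⟨Subgroup.mem_top x, hx⟩, le_rfl, fun _ _ => rfl⟩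
  mul_one := by
    rintro ⟨α⟩
    exact Quotient.sound ⟨α.source, α.source_finiteIndex,
      fun x hx => PartialIso.mem_preimage.2 ⟨hx, Subgroup.mem_top _⟩, le_rfl, fun _ _ => rfl⟩
  inv_mul_cancel := by
    rintro ⟨α⟩
    refine Quotient.sound ⟨α.target, α.target_finiteIndex,
      fun x hx => PartialIso.mem_preimage.2 ⟨hx, Subtype.property _⟩, le_top, fun x hx => ?_⟩
    change ((α.iso (α.iso.symm ⟨x, hx⟩) : α.target) : G) = x
    simp

theorem mk_mul_mk (α β : PartialIso G) : mk α * mk β = mk (α.mul β) := rfl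

end Comm

/-! ### Partial isomorphisms: indices of domains and consequences of unique roots. -/

namespace PartialIso

variable {G : Type*} [Group G]

/-! Suppose `Comm G` is finitely generated. Composing with a generator or its inverse multiplies the
index of the domain by a bounded factor, so for a large prime p every class has a representative α
whose domain has index prime to p (`exists_bound_of_fg`). Let K be the kernel of the t-exponent mod
p, of index p. It belongs to a cyclic cover with p edges; twisting one edge by a generator x of C
gives an automorphism b of K (`kerTwist`) that sends t^p to t^p x and fixes t^i A t^-i pointwise for
0 ≤ i < p.

Represent the class of b by such an α. Its domain and K generate G, and unique roots make α and b
agree where both are defined. Writing t = gk with α(g) and b(k) defined, u = α(g)b(k) plays the role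
of the image of t; in particular u^p = t^p x (`exists_root_of_equivalent`).

No such u exists. If A equals C or D, the group is a solvable Baumslag–Solitar group, and the root
would give m(1 + s + ... + s^(p-1)) = s^k in ℤ (`pow_ne_pow_mul_of_conj_eq`). Otherwise the
centraliser of A lies in A, which forces z = t^-1 u and its conjugates by small powers of t into C;
the root then gives a geometric progression of p integers with sum 1
(`mul_pow_ne_pow_mul_of_conj_mem_zpowers`). Both are impossible for odd p, the ratio -1 being
excluded by unique roots. -/

theorem index_preimage_eq (α : PartialIso G) (K : Subgroup G) :
    (α.preimage K).index = K.relIndex α.target * α.source.index := by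
  rw [preimage, Subgroup.index_map_subtype, Subgroup.index_comap]
  congr 2
  ext x
  constructor
  · rintro ⟨y, rfl⟩
    exact Subtype.property _
  · intro hx
    exact ⟨α.iso.symm ⟨x, hx⟩, by simp⟩

/-- The new factor in the index is the relative index of `β.source` in `α.target`, which is nonzero
and at most `β.source.index`, hence less than `p`. -/
theorem index_mul_source_not_dvd {α β : PartialIso G} {p : ℕ} (hp : p.Prime)
    (hα : ¬ p ∣ α.source.index) (hβ : β.source.index < p) :
    ¬ p ∣ (α.mul β).source.index := by
  change ¬ p ∣ (α.preimage β.source).index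
  rw [index_preimage_eq, hp.dvd_mul, not_or]
  refine ⟨fun h => ?_, hα⟩
  have h0 : β.source.relIndex α.target ≠ 0 := fun h =>
    β.source_finiteIndex.index_ne_zero (Subgroup.index_eq_zero_of_relIndex_eq_zero h)
  have h1 : β.source.relIndex α.target ≤ β.source.index := by
    have := β.source_finiteIndex
    rw [← Subgroup.relIndex_top_right]
    exact Subgroup.relIndex_le_of_le_right le_top
      (by rw [Subgroup.relIndex_top_right]; exact this.index_ne_zero)
  have := Nat.le_of_dvd (Nat.pos_of_ne_zero h0) h
  omega

/-- With unique roots, equivalent isomorphisms agree wherever both are defined. -/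
theorem Equivalent.eq_of_mem (hG : UniqueRootProperty G) {α β : PartialIso G}
    (h : Equivalent α β) (x : G) (hα : x ∈ α.source) (hβ : x ∈ β.source) :
    (α.iso ⟨x, hα⟩ : G) = β.iso ⟨x, hβ⟩ := by
  obtain ⟨H, hH, h1, h2, h⟩ := h
  obtain ⟨n, hn, -, hx⟩ := Subgroup.exists_pow_mem_of_index_ne_zero hH.index_ne_zero x
  refine hG _ _ n hn ?_
  have := h (x ^ n) hx
  have e1 : (⟨x ^ n, h1 hx⟩ : α.source) = ⟨x, hα⟩ ^ n := rfl
  have e2 : (⟨x ^ n, h2 hx⟩ : β.source) = ⟨x, hβ⟩ ^ n := rfl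
  rwa [e1, e2, map_pow, map_pow] at this

open scoped Pointwise in
/-- If an isomorphism `β` defined on a normal subgroup of prime index `p` is equivalent to one
whose domain has index prime to `p`, then `β` extends over each element `t` of the group,
with some `u` playing the role of the image of `t`. -/
theorem exists_root_of_equivalent (hG : UniqueRootProperty G) {p : ℕ} (hp : p.Prime)
    {α β : PartialIso G} (h : Equivalent α β) (hα : ¬ p ∣ α.source.index)
    (hβ : β.source.index = p) (hn : β.source.Normal) (t : G) :
    ∃ u : G, (∀ ht : t ^ p ∈ β.source, u ^ p = β.iso ⟨t ^ p, ht⟩) ∧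
      ∀ (y : G) (hy : y ∈ β.source) (hy' : t * y * t⁻¹ ∈ β.source),
        (β.iso ⟨t * y * t⁻¹, hy'⟩ : G) = u * β.iso ⟨y, hy⟩ * u⁻¹ := by
  have hsup : α.source ⊔ β.source = ⊤ := by
    rw [← Subgroup.index_eq_one]
    have h1 := Subgroup.index_dvd_of_le (le_sup_left : α.source ≤ α.source ⊔ β.source)
    have h2 := Subgroup.index_dvd_of_le (le_sup_right : β.source ≤ α.source ⊔ β.source)
    rw [hβ, Nat.dvd_prime hp] at h2
    rcases h2 with h2 | h2
    · exact h2
    · rw [h2] at h1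
      exact absurd h1 hα
  obtain ⟨g, hg, k, hk, rfl⟩ : t ∈ (α.source : Set G) * (β.source : Set G) := by
    rw [← Subgroup.mul_normal, hsup]
    trivial
  simp only [SetLike.mem_coe] at hg hk
  -- Some power `y ^ m` lies in both domains, where `α` can be applied to the conjugate factor by
  -- factor; unique roots then remove the exponent `m`.
  have conj : ∀ (n : ℕ) (y : G) (hy : y ∈ β.source) (hy' : g ^ n * y * (g ^ n)⁻¹ ∈ β.source),
      (β.iso ⟨g ^ n * y * (g ^ n)⁻¹, hy'⟩ : G) =
        (α.iso ⟨g, hg⟩ : G) ^ n * β.iso ⟨y, hy⟩ * ((α.iso ⟨g, hg⟩ : G) ^ n)⁻¹ := by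
    intro n y hy hy'
    have hfin : (α.source ⊓ β.source).FiniteIndex :=
      have := α.source_finiteIndex
      have := β.source_finiteIndex
      inferInstance
    obtain ⟨m, hm, -, hx⟩ := Subgroup.exists_pow_mem_of_index_ne_zero hfin.index_ne_zero y
    refine hG _ _ m hm ?_
    have hgn : g ^ n ∈ α.source := pow_mem hg n
    have hcα : g ^ n * y ^ m * (g ^ n)⁻¹ ∈ α.source :=
      mul_mem (mul_mem hgn hx.1) (inv_mem hgn)
    have hcβ : g ^ n * y ^ m * (g ^ n)⁻¹ ∈ β.source := hn.conj_mem _ hx.2 _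
    rw [conj_pow]
    have e1 : (⟨g ^ n * y * (g ^ n)⁻¹, hy'⟩ : β.source) ^ m =
        ⟨g ^ n * y ^ m * (g ^ n)⁻¹, hcβ⟩ := Subtype.ext (by simp [conj_pow])
    have e2 : (⟨g ^ n * y ^ m * (g ^ n)⁻¹, hcα⟩ : α.source) =
        ⟨g, hg⟩ ^ n * ⟨y ^ m, hx.1⟩ * (⟨g, hg⟩ ^ n)⁻¹ := rfl
    have e3 : (⟨y ^ m, hx.2⟩ : β.source) = ⟨y, hy⟩ ^ m := rfl
    rw [← Subgroup.coe_pow, ← map_pow, e1, ← h.eq_of_mem hG _ hcα hcβ, e2, map_mul, map_mul,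
      map_inv, map_pow]
    simp only [Subgroup.coe_mul, Subgroup.coe_inv, Subgroup.coe_pow]
    rw [h.eq_of_mem hG _ hx.1 hx.2, e3, map_pow, Subgroup.coe_pow]
  -- Splitting `(g * k) ^ j` as `g ^ j` times an element of `β.source` is useful at `j = p`: there
  -- `g ^ p` also lies in `β.source`, so `α` and `β` agree on it.
  have hmem : ∀ j : ℕ, (g ^ j)⁻¹ * (g * k) ^ j ∈ β.source := by
    intro j
    induction j with
    | zero => simp
    | succ j ih =>
      have e : (g ^ (j + 1))⁻¹ * (g * k) ^ (j + 1) =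
          g⁻¹ * ((g ^ j)⁻¹ * (g * k) ^ j) * g⁻¹⁻¹ * k := by
        rw [pow_succ, pow_succ]; group
      rw [e]
      exact mul_mem (hn.conj_mem _ ih _) hk
  have hpow : ∀ j : ℕ, ((α.iso ⟨g, hg⟩ : G) * β.iso ⟨k, hk⟩) ^ j =
      (α.iso ⟨g, hg⟩ : G) ^ j * β.iso ⟨_, hmem j⟩ := by
    intro j
    induction j with
    | zero =>
      have : (⟨_, hmem 0⟩ : β.source) = 1 := Subtype.ext (by simp)
      rw [this]; simp
    | succ j ih =>
      have hm' : g⁻¹ * ((g ^ j)⁻¹ * (g * k) ^ j) * g ∈ β.source := by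
        simpa using hn.conj_mem _ (hmem j) g⁻¹
      have e : (⟨_, hmem (j + 1)⟩ : β.source) =
          ⟨g⁻¹ * ((g ^ j)⁻¹ * (g * k) ^ j) * g, hm'⟩ * ⟨k, hk⟩ :=
        Subtype.ext (by simp only [Subgroup.coe_mul]; rw [pow_succ, pow_succ]; group)
      have hc := conj 1 _ hm' (by simpa [mul_assoc] using hmem j)
      have e' : (⟨g ^ 1 * (g⁻¹ * ((g ^ j)⁻¹ * (g * k) ^ j) * g) * (g ^ 1)⁻¹,
          by simpa [mul_assoc] using hmem j⟩ : β.source) = ⟨_, hmem j⟩ :=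
        Subtype.ext (by group)
      rw [e'] at hc
      rw [pow_succ, ih, e, map_mul, Subgroup.coe_mul, hc, pow_succ]
      group
  refine ⟨α.iso ⟨g, hg⟩ * β.iso ⟨k, hk⟩, fun ht => ?_, fun y hy hy' => ?_⟩
  · have hgp : g ^ p ∈ β.source := by
      have := hn
      have h1 := Subgroup.pow_index_mem β.source g
      rwa [hβ] at h1
    have e : (⟨(g * k) ^ p, ht⟩ : β.source) = ⟨g ^ p, hgp⟩ * ⟨_, hmem p⟩ :=
      Subtype.ext (by simp)
    rw [hpow, e, map_mul, Subgroup.coe_mul, ← h.eq_of_mem hG _ (pow_mem hg p) hgp]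
    have e2 : (⟨g ^ p, pow_mem hg p⟩ : α.source) = ⟨g, hg⟩ ^ p := rfl
    rw [e2, map_pow, Subgroup.coe_pow]
  · have hk' : k * y * k⁻¹ ∈ β.source := hn.conj_mem _ hy _
    have hc := conj 1 _ hk' (hn.conj_mem _ hk' _)
    have e : (⟨g * k * y * (g * k)⁻¹, hy'⟩ : β.source) =
        ⟨g ^ 1 * (k * y * k⁻¹) * (g ^ 1)⁻¹, hn.conj_mem _ hk' _⟩ :=
      Subtype.ext (by group)
    have e2 : (⟨k * y * k⁻¹, hk'⟩ : β.source) = ⟨k, hk⟩ * ⟨y, hy⟩ * ⟨k, hk⟩⁻¹ := rfl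
    rw [e, hc, e2, map_mul, map_mul, map_inv]
    simp only [Subgroup.coe_mul, Subgroup.coe_inv]
    group

end PartialIso

/-! ### Consequences of finite generation of the commensurator. -/

namespace Comm

variable {G : Type*} [Group G]

/-- If the commensurator is finitely generated, then for every large prime `p` each of its
elements is represented by an isomorphism whose domain has index prime to `p`. -/
theorem exists_bound_of_fg (h : Group.FG (Comm G)) :
    ∃ N : ℕ, ∀ p : ℕ, p.Prime → N < p → ∀ x : Comm G,
      ∃ α : PartialIso G, mk α = x ∧ ¬ p ∣ α.source.index := by
  obtain ⟨S, hS⟩ := Group.fg_def.1 h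
  have hrep : ∀ x : Comm G, ∃ α, mk α = x := Quotient.exists_rep
  choose r hr using hrep
  -- Target indices are included because they are the domain indices of the inverse generators.
  refine ⟨∑ s ∈ S, ((r s).source.index + (r s).target.index), fun p hp hN x => ?_⟩
  have hlt : ∀ s ∈ S, (r s).source.index < p ∧ (r s).target.index < p := by
    intro s hs
    have := Finset.single_le_sum
      (f := fun s => (r s).source.index + (r s).target.index) (fun _ _ => Nat.zero_le _) hs
    omega
  have hx : x ∈ Subgroup.closure (S : Set (Comm G)) := hS ▸ Subgroup.mem_top x
  induction hx using Subgroup.closure_induction_right with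
  | one =>
    exact ⟨PartialIso.refl G, rfl, by
      simpa [PartialIso.refl] using hp.one_lt.ne'⟩
  | mul_right x _ s hs ih =>
    obtain ⟨α, rfl, hα⟩ := ih
    refine ⟨α.mul (r s), by rw [← mk_mul_mk, hr], ?_⟩
    exact PartialIso.index_mul_source_not_dvd hp hα (hlt s hs).1
  | mul_inv_cancel x _ s hs ih =>
    obtain ⟨α, rfl, hα⟩ := ih
    refine ⟨α.mul (r s).symm, ?_, ?_⟩
    · rw [← mk_mul_mk]
      congr 1
      conv_rhs => rw [← hr s]
      rfl
    · exact PartialIso.index_mul_source_not_dvd hp hα (hlt s hs).2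

/-- If `G ≃* Γ` has unique roots and finitely generated commensurator, then for every large
prime `p`, an automorphism `b` of a normal subgroup `K` of index `p` in `Γ` extends over each
`t : Γ`, with some `u` playing the role of the image of `t`. -/
theorem exists_root_of_fg {Γ : Type*} [Group Γ] (e : G ≃* Γ) (hG : UniqueRootProperty G)
    (h : Group.FG (Comm G)) :
    ∃ N : ℕ, ∀ p : ℕ, p.Prime → N < p → ∀ K : Subgroup Γ, K.Normal → K.index = p →
      ∀ (b : K ≃* K) (t : Γ), ∃ u : Γ, (∀ ht : t ^ p ∈ K, u ^ p = b ⟨t ^ p, ht⟩) ∧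
        ∀ (y : Γ) (hy : y ∈ K) (hy' : t * y * t⁻¹ ∈ K),
          (b ⟨t * y * t⁻¹, hy'⟩ : Γ) = u * b ⟨y, hy⟩ * u⁻¹ := by
  obtain ⟨N, hN⟩ := exists_bound_of_fg h
  refine ⟨N, fun p hp hlt K hK hKp b t => ?_⟩
  have hidx : (K.map e.symm.toMonoidHom).index = p := by
    rw [← hKp]; exact Subgroup.index_map_equiv K e.symm
  have hfin : (K.map e.symm.toMonoidHom).FiniteIndex := ⟨by rw [hidx]; exact hp.ne_zero⟩
  let β : PartialIso G :=
    { source := K.map e.symm.toMonoidHom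
      target := K.map e.symm.toMonoidHom
      source_finiteIndex := hfin
      target_finiteIndex := hfin
      iso := (e.symm.subgroupMap K).symm.trans (b.trans (e.symm.subgroupMap K)) }
  have hβ : ∀ (y : Γ) (hy : y ∈ K) (hy' : e.symm y ∈ β.source),
      (β.iso ⟨e.symm y, hy'⟩ : G) = e.symm (b ⟨y, hy⟩) := by
    intro y hy hy'
    have : (⟨e.symm y, hy'⟩ : K.map e.symm.toMonoidHom) = e.symm.subgroupMap K ⟨y, hy⟩ := rfl
    change ((e.symm.subgroupMap K (b ((e.symm.subgroupMap K).symm _)) :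
      K.map e.symm.toMonoidHom) : G) = _
    rw [this, MulEquiv.symm_apply_apply]
    rfl
  have hmem : ∀ y ∈ K, e.symm y ∈ β.source := fun y hy => ⟨y, hy, rfl⟩
  obtain ⟨α, hα, hpα⟩ := hN p hp hlt (mk β)
  obtain ⟨u, hu1, hu2⟩ := PartialIso.exists_root_of_equivalent hG hp
    (Quotient.exact hα : PartialIso.Equivalent α β) hpα hidx
    (hK.map _ e.symm.surjective) (e.symm t)
  refine ⟨e u, fun ht => ?_, fun y hy hy' => ?_⟩
  · apply e.symm.injective
    have h1 := hmem _ ht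
    rw [map_pow] at h1
    rw [map_pow, e.symm_apply_apply, hu1 h1, ← hβ _ ht (hmem _ ht)]
    congr 2
    exact Subtype.ext (by simp)
  · apply e.symm.injective
    have h1 := hmem _ hy'
    simp only [map_mul, map_inv] at h1
    rw [map_mul, map_mul, map_inv, e.symm_apply_apply, ← hβ _ hy (hmem _ hy),
      ← hu2 _ (hmem _ hy) h1, ← hβ _ hy' (hmem _ hy')]
    congr 2
    exact Subtype.ext (by simp)

end Comm

/-! ### The twist automorphism of a cyclic cover. -/

namespace HNNExtension

variable {A : Type*} [Group A] {C D : Subgroup A} {φ : C ≃* D} {Q : Type*} [Group Q]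

/-- Constant functions in a regular wreath product. -/
def wreathConst (f : A →* HNNExtension A C D φ) : A →* HNNExtension A C D φ ≀ᵣ Q where
  toFun a := ⟨fun _ => f a, 1⟩
  map_one' := by ext <;> simp
  map_mul' a b := by ext <;> simp

open Classical in
/-- The embedding of an HNN extension in the wreath product over `Q` given by `t ↦ (t, q)`,
twisted over one edge of the `Q`-cover by an element `x` centralising `C`. -/
noncomputable def wreathTwist (q : Q) (x : A) (hx : ∀ y ∈ C, Commute x y) :
    HNNExtension A C D φ →* HNNExtension A C D φ ≀ᵣ Q :=
  lift (wreathConst of) ⟨fun i => if i = q then t * of x else t, q⟩ <| by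
    intro a
    ext i
    · simp only [wreathConst, MonoidHom.coe_mk, OneHom.coe_mk, RegularWreathProduct.mul_left,
        Pi.mul_apply, inv_one, one_mul]
      split_ifs
      · rw [mul_assoc, ← map_mul, (hx _ a.2).eq, map_mul, ← mul_assoc, t_mul_of, mul_assoc]
      · exact t_mul_of a
    · simp [wreathConst]

variable (q : Q) (x : A) (hx : ∀ y ∈ C, Commute x y)

theorem wreathTwist_of (a : A) :
    wreathTwist (φ := φ) q x hx (of a) = ⟨fun _ => of a, 1⟩ := by
  simp [wreathTwist, wreathConst]

open Classical in
theorem wreathTwist_t :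
    wreathTwist (φ := φ) q x hx t = ⟨fun i => if i = q then t * of x else t, q⟩ := by
  simp [wreathTwist]

/-- The exponent of `t`, as a power of `q`. -/
noncomputable def exponent (φ : C ≃* D) (q : Q) : HNNExtension A C D φ →* Q :=
  lift 1 q (by simp)

@[simp] theorem exponent_of (a : A) : exponent φ q (of a) = 1 := by simp [exponent]

@[simp] theorem exponent_t : exponent φ q t = q := by simp [exponent]

@[simp] theorem wreathTwist_right (w : HNNExtension A C D φ) :
    (wreathTwist q x hx w).right = exponent φ q w := by
  have : RegularWreathProduct.rightHom.comp (wreathTwist q x hx) = exponent φ q :=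
    hom_ext (by ext a; simp [wreathTwist_of]) (by simp [wreathTwist_t])
  exact DFunLike.congr_fun this w

/-- The cocycle describing the twist of the `Q`-cover along one edge. -/
noncomputable def twist (w : HNNExtension A C D φ) : Q → HNNExtension A C D φ :=
  (wreathTwist q x hx w).left

theorem twist_mul (v w : HNNExtension A C D φ) (i : Q) :
    twist q x hx (v * w) i = twist q x hx v i * twist q x hx w ((exponent φ q v)⁻¹ * i) := by
  simp [twist]

theorem twist_inv (w : HNNExtension A C D φ) (i : Q) :
    twist q x hx w⁻¹ i = (twist q x hx w (exponent φ q w * i))⁻¹ := by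
  simp [twist]

theorem twist_of (a : A) (i : Q) : twist (φ := φ) q x hx (of a) i = of a := by
  simp [twist, wreathTwist_of]

theorem twist_t_self : twist (φ := φ) q x hx t q = t * of x := by
  simp [twist, wreathTwist_t]

theorem twist_t_of_ne {i : Q} (hi : i ≠ q) : twist (φ := φ) q x hx t i = t := by
  simp [twist, wreathTwist_t, hi]

theorem exponent_twist (w : HNNExtension A C D φ) (i : Q) :
    exponent φ q (twist q x hx w i) = exponent φ q w := by
  induction w using induction_on generalizing i with
  | of a => rw [twist_of]
  | t =>
    by_cases hi : i = q
    · subst hi; simp [twist_t_self]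
    · rw [twist_t_of_ne _ _ _ hi]
  | mul v w hv hw => rw [twist_mul, map_mul, hv, hw, map_mul]
  | inv w hw => rw [twist_inv, map_inv, hw, map_inv]

/-- Twisting preserves the exponent, so both cocycles visit the same coordinates, and on the twisted
edge `t` becomes `t * of x * of y`. -/
theorem twist_twist_inv {y : A} (hy : ∀ c ∈ C, Commute y c) (hxy : x * y = 1)
    (w : HNNExtension A C D φ) (i : Q) :
    twist q x hx (twist q y hy w i) i = w := by
  induction w using induction_on generalizing i with
  | of a => rw [twist_of, twist_of]
  | t =>
    by_cases hi : i = q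
    · subst hi
      rw [twist_t_self, twist_mul, twist_t_self, twist_of, mul_assoc, ← map_mul, hxy, map_one,
        mul_one]
    · rw [twist_t_of_ne _ _ _ hi, twist_t_of_ne _ _ _ hi]
  | mul v w hv hw => rw [twist_mul, twist_mul, hv, exponent_twist, hw]
  | inv w hw => rw [twist_inv, twist_inv, exponent_twist, hw]

/-- The twist along one edge of the `Q`-cover, as an automorphism of the kernel of the
exponent map. -/
noncomputable def kerTwist : (exponent φ q).ker ≃* (exponent φ q).ker where
  toFun w := ⟨twist q x hx w 1, by rw [MonoidHom.mem_ker, exponent_twist]; exact w.2⟩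
  invFun w := ⟨twist q x⁻¹ (fun c hc => (hx c hc).inv_left) w 1,
    by rw [MonoidHom.mem_ker, exponent_twist]; exact w.2⟩
  left_inv w := Subtype.ext (twist_twist_inv _ _ _ _ (inv_mul_cancel x) _ _)
  right_inv w := Subtype.ext (twist_twist_inv _ _ _ _ (mul_inv_cancel x) _ _)
  map_mul' v w := by
    apply Subtype.ext
    simp only [Subgroup.coe_mul]
    rw [twist_mul, MonoidHom.mem_ker.1 v.2, inv_one, one_mul]

theorem coe_kerTwist (w : HNNExtension A C D φ) (hw : w ∈ (exponent φ q).ker) :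
    (kerTwist q x hx ⟨w, hw⟩ : HNNExtension A C D φ) = twist q x hx w 1 := rfl

/-- Read from coordinate 1, the successive letters `t` sit at 1, q⁻¹, q⁻², ...; the twisted
coordinate `q` is first met at letter number `orderOf q`. -/
theorem twist_t_pow_one {n : ℕ} (hn : n < orderOf q) : twist (φ := φ) q x hx (t ^ n) 1 = t ^ n := by
  induction n with
  | zero => simp [twist]
  | succ n ih =>
    rw [pow_succ, twist_mul, ih (by omega), twist_t_of_ne]
    rw [map_pow, exponent_t, mul_one]
    intro h
    rw [inv_eq_iff_mul_eq_one, ← pow_succ] at h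
    exact pow_ne_one_of_lt_orderOf n.succ_ne_zero hn h

theorem twist_t_pow_orderOf (hq : orderOf q ≠ 0) :
    twist (φ := φ) q x hx (t ^ orderOf q) 1 = t ^ orderOf q * of x := by
  obtain ⟨n, hn⟩ := Nat.exists_eq_succ_of_ne_zero hq
  rw [hn, pow_succ, twist_mul, twist_t_pow_one _ _ _ (by omega), map_pow, exponent_t, mul_one,
    mul_assoc]
  have : (q ^ n)⁻¹ = q := by
    rw [inv_eq_iff_mul_eq_one, ← pow_succ, ← Nat.succ_eq_add_one, ← hn, pow_orderOf_eq_one]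
  rw [this, twist_t_self]

theorem twist_conj_t_pow {n : ℕ} (hn : n < orderOf q) (a : A) :
    twist (φ := φ) q x hx (t ^ n * of a * (t ^ n)⁻¹) 1 = t ^ n * of a * (t ^ n)⁻¹ := by
  rw [twist_mul, twist_mul, twist_inv, twist_t_pow_one _ _ _ hn, twist_of]
  simp [twist_t_pow_one _ _ _ hn]

theorem twist_conj_t_inv (a : A) :
    twist (φ := φ) q x hx (t⁻¹ * of a * t) 1 = (t * of x)⁻¹ * of a * (t * of x) := by
  rw [twist_mul, twist_mul, twist_inv, twist_of]
  simp [twist_t_self]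

end HNNExtension

/-! ### Centralisers and membership from reduced words. -/

namespace HNNExtension

open NormalWord

variable {A : Type*} [Group A] {C D : Subgroup A} {φ : C ≃* D}

theorem exists_reducedWord_prod_eq (w : HNNExtension A C D φ) :
    ∃ r : ReducedWord A C D, r.prod φ = w := by
  obtain ⟨d⟩ := TransversalPair.nonempty A C D
  exact ⟨(w • (NormalWord.empty : NormalWord d)).toReducedWord, by
    exact (prod_smul φ w _).trans (by simp)⟩

/-- The chain condition does not constrain the base element of the last letter, so `a` can be
absorbed there. -/
theorem exists_chain_mul_of (a : A) : ∀ l : List (ℤˣ × A), l ≠ [] →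
    l.IsChain (fun a b => a.2 ∈ toSubgroup C D a.1 → a.1 = b.1) →
    ∃ l' : List (ℤˣ × A), l'.IsChain (fun a b => a.2 ∈ toSubgroup C D a.1 → a.1 = b.1) ∧
      l'.map Prod.fst = l.map Prod.fst ∧
      (l'.map fun x => (t ^ (x.1 : ℤ) * of x.2 : HNNExtension A C D φ)).prod =
        (l.map fun x => (t ^ (x.1 : ℤ) * of x.2 : HNNExtension A C D φ)).prod * of a
  | [], h, _ => absurd rfl h
  | [x], _, _ => ⟨[(x.1, x.2 * a)], by simp, by simp, by simp [mul_assoc]⟩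
  | x :: y :: l, _, h => by
    obtain ⟨l', h1, h2, h3⟩ := exists_chain_mul_of a (y :: l) (by simp)
      (List.isChain_cons_cons.1 h).2
    match l', h1, h2, h3 with
    | y' :: l', h1, h2, h3 =>
      have hy : y'.1 = y.1 := by simp at h2; exact h2.1
      refine ⟨x :: y' :: l', List.isChain_cons_cons.2 ⟨?_, h1⟩, ?_, ?_⟩
      · rw [hy]; exact (List.isChain_cons_cons.1 h).1
      · rw [List.map_cons, h2]; rfl
      · rw [List.map_cons, List.prod_cons, h3, List.map_cons (l := y :: l), List.prod_cons]
        simp only [mul_assoc]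

/-- The centraliser of the base group is contained in the base group, unless the latter is one
of the associated subgroups. -/
theorem mem_range_of_of_commute (hC : C ≠ ⊤) (hD : D ≠ ⊤) {z : HNNExtension A C D φ}
    (hz : ∀ a, z * of a = of a * z) : z ∈ (of : A →* HNNExtension A C D φ).range := by
  obtain ⟨⟨g, l, hl⟩, rfl⟩ := exists_reducedWord_prod_eq z
  rcases l with _ | ⟨x, l⟩
  · exact ⟨g, by simp [ReducedWord.prod]⟩
  exfalso
  have htop : toSubgroup C D (-x.1) = ⊤ := by
    rw [eq_top_iff]
    intro a _
    -- Commuting with this element gives two reduced words for one product, with heads `g * a⁻¹` and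
    -- `g`; uniqueness puts their quotient `a` in the associated subgroup.
    obtain ⟨l', h1, -, h3⟩ := exists_chain_mul_of (φ := φ) (g * a * g⁻¹)⁻¹ _
      (List.cons_ne_nil x l) hl
    have := (ReducedWord.map_fst_eq_and_of_prod_eq φ
      (w₁ := ⟨(g * a * g⁻¹)⁻¹ * g, x :: l, hl⟩) (w₂ := ⟨g, l', h1⟩) (by
        have := hz (g * a * g⁻¹)⁻¹
        simp only [ReducedWord.prod] at this ⊢
        rw [h3, map_mul, mul_assoc, ← this, mul_assoc])).2 x.1 (by simp)
    convert this using 1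
    group
  rcases Int.units_eq_one_or x.1 with h | h <;> rw [h] at htop
  · exact hD htop
  · rw [neg_neg] at htop
    exact hC htop

theorem mem_of_of_mul_t_eq {a b : A} (h : (of a : HNNExtension A C D φ) * t = t * of b) :
    a ∈ D := by
  have := (ReducedWord.map_fst_eq_and_of_prod_eq φ
    (w₁ := ⟨a, [(1, 1)], List.isChain_singleton _⟩)
    (w₂ := ⟨1, [(1, b)], List.isChain_singleton _⟩)
    (by simpa [ReducedWord.prod] using h)).2 1 (by simp)
  simpa using this

theorem mem_of_t_mul_of_eq {a b : A} (h : (t : HNNExtension A C D φ) * of a = of b * t) :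
    a ∈ C := by
  have hb : b ∈ D := mem_of_of_mul_t_eq h.symm
  have h1 := of_mul_t (φ := φ) ⟨b, hb⟩
  simp only at h1
  rw [← h] at h1
  rw [of_injective _ (mul_left_cancel h1)]
  exact Subtype.property _

end HNNExtension

/-! ### Integer geometric sums of odd length. -/

open Finset in
theorem int_two_le_geom_sum₂_of_pos {x y : ℤ} (hx : 0 < x) (hy : 0 < y) {p : ℕ} (hp : 2 ≤ p) :
    2 ≤ ∑ i ∈ range p, x ^ i * y ^ (p - 1 - i) := by
  have h : ∑ _i ∈ range p, (1 : ℤ) ≤ ∑ i ∈ range p, x ^ i * y ^ (p - 1 - i) :=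
    sum_le_sum fun i _ => show 0 < x ^ i * y ^ (p - 1 - i) by positivity
  simp only [sum_const, card_range, nsmul_eq_mul, mul_one] at h
  have : (2 : ℤ) ≤ p := by exact_mod_cast hp
  omega

-- As p - 1 is even, changing both signs is harmless. For equal signs the sum is at least 2. For a >
-- 0 > b, multiplying by a - b gives a^p + |b|^p ≥ a + |b|, with equality only if a = |b| = 1, that
-- is a + b = 0.
open Finset in
theorem int_not_isUnit_geom_sum₂ {x y : ℤ} (hx : x ≠ 0) (hy : y ≠ 0) (hxy : x + y ≠ 0) {p : ℕ}
    (hp : Odd p) (hp1 : p ≠ 1) : ¬ IsUnit (∑ i ∈ range p, x ^ i * y ^ (p - 1 - i)) := by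
  have hp2 : 2 ≤ p := by
    obtain ⟨k, rfl⟩ := hp
    omega
  have neg : ∀ a b : ℤ, ∑ i ∈ range p, (-a) ^ i * (-b) ^ (p - 1 - i) =
      ∑ i ∈ range p, a ^ i * b ^ (p - 1 - i) := by
    intro a b
    refine sum_congr rfl fun i hi => ?_
    have hi := mem_range.1 hi
    have he : Even (p - 1) := hp.tsub_odd odd_one
    rw [neg_pow a, neg_pow b, mul_mul_mul_comm, ← pow_add,
      show i + (p - 1 - i) = p - 1 by omega, he.neg_one_pow, one_mul]
  have opp : ∀ a b : ℤ, 0 < a → b < 0 → a + b ≠ 0 →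
      ¬ IsUnit (∑ i ∈ range p, a ^ i * b ^ (p - 1 - i)) := by
    intro a b ha hb hab hu
    have hg := Commute.geom_sum₂_mul (Commute.all a b) p
    have ha1 : a ≤ a ^ p := le_self_pow₀ (by omega) (by omega)
    have hb1 : -b ≤ (-b) ^ p := le_self_pow₀ (by omega) (by omega)
    have hbp : (-b) ^ p = -b ^ p := hp.neg_pow b
    rcases Int.isUnit_iff.1 hu with h | h <;> rw [h] at hg
    · have ha2 : a ^ p = a := by omega
      have hb2 : (-b) ^ p = -b := by omega
      have one : ∀ z : ℤ, 0 < z → z ^ p = z → z = 1 := by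
        intro z hz hzp
        by_contra hne
        have := lt_self_pow₀ (a := z) (m := p) (by omega) (by omega)
        omega
      have := one a ha ha2
      have := one (-b) (by omega) hb2
      omega
    · omega
  rcases lt_or_gt_of_ne hx with hx | hx <;> rcases lt_or_gt_of_ne hy with hy | hy
  · intro hu
    have := int_two_le_geom_sum₂_of_pos (neg_pos.2 hx) (neg_pos.2 hy) hp2
    rw [neg] at this
    rcases Int.isUnit_iff.1 hu with h | h <;> omega
  · rw [← neg]
    exact opp _ _ (by omega) (by omega) (by omega)
  · exact opp _ _ hx hy hxy
  · intro hu
    have := int_two_le_geom_sum₂_of_pos hx hy hp2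
    rcases Int.isUnit_iff.1 hu with h | h <;> omega

open Finset in
/-- A geometric progression of odd length in `ℤ`, of ratio other than `0` and `-1`,
does not sum to one. -/
theorem int_sum_ne_one_of_geometric {p : ℕ} (hp : Odd p) (hp1 : p ≠ 1) (m : ℕ → ℤ)
    (h0 : m 0 ≠ 0) (h1 : m 1 ≠ 0) (hneg : m 0 + m 1 ≠ 0)
    (hm : ∀ i, i + 1 < p → m 0 * m (i + 1) = m 1 * m i) : ∑ i ∈ range p, m i ≠ 1 := by
  intro hsum
  have hp0 : 0 < p := hp.pos
  -- The ratio is s/r in lowest terms. Integrality of the last term forces `r ^ (p - 1)` to divide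
  -- `m 0`, so the whole sum is a multiple of a homogeneous geometric sum.
  obtain ⟨g, r, s, hg, hrs, hr, hs⟩ :=
    Int.exists_gcd_one' (m := m 0) (n := m 1) (Int.gcd_pos_of_ne_zero_left _ h0)
  have hg0 : (g : ℤ) ≠ 0 := by exact_mod_cast hg.ne'
  have hr0 : r ≠ 0 := by rintro rfl; simp at hr; exact h0 hr
  have hs0 : s ≠ 0 := by rintro rfl; simp at hs; exact h1 hs
  have hrs0 : r + s ≠ 0 := by
    intro h
    apply hneg
    rw [hr, hs, ← add_mul, h, zero_mul]
  have hm' : ∀ i, i + 1 < p → r * m (i + 1) = s * m i := by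
    intro i hi
    have := hm i hi
    rw [hr, hs] at this
    apply mul_right_cancel₀ hg0
    linear_combination this
  have hpow : ∀ i, i < p → r ^ i * m i = s ^ i * m 0 := by
    intro i
    induction i with
    | zero => simp
    | succ i ih =>
      intro hi
      have h2 := hm' i hi
      have h3 := ih (by omega)
      rw [pow_succ, pow_succ]
      linear_combination r ^ i * h2 + s * h3
  have hdvd : r ^ (p - 1) ∣ m 0 := by
    have : r ^ (p - 1) ∣ s ^ (p - 1) * m 0 := ⟨_, (hpow (p - 1) (by omega)).symm⟩
    exact ((Int.isCoprime_iff_gcd_eq_one.2 hrs).pow).dvd_of_dvd_mul_left this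
  obtain ⟨l, hl⟩ := hdvd
  have hml : ∀ i ∈ range p, m i = s ^ i * r ^ (p - 1 - i) * l := by
    intro i hi
    have hi := mem_range.1 hi
    apply mul_left_cancel₀ (pow_ne_zero i hr0)
    rw [hpow i hi, hl]
    conv_lhs => rw [show p - 1 = i + (p - 1 - i) by omega, pow_add]
    ring
  rw [sum_congr rfl hml, ← sum_mul] at hsum
  exact int_not_isUnit_geom_sum₂ hs0 hr0 (by omega) hp hp1 (IsUnit.of_mul_eq_one _ hsum)

-- The geometric sum is 1 mod `s`, hence coprime to `s`; dividing a power of `s` would make it a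
-- unit.
open Finset in
theorem int_mul_geom_sum_ne_pow {p : ℕ} (hp : Odd p) (hp1 : p ≠ 1) {s : ℤ} (h0 : s ≠ 0)
    (h1 : s ≠ -1) (m : ℤ) (k : ℕ) : m * ∑ i ∈ range p, s ^ i ≠ s ^ k := by
  intro h
  have hcop : IsCoprime (∑ i ∈ range p, s ^ i) s := by
    obtain ⟨q, rfl⟩ : ∃ q, p = q + 1 := ⟨p - 1, by have := hp.pos; omega⟩
    rw [sum_range_succ', pow_zero]
    refine ⟨1, -∑ i ∈ range q, s ^ i, ?_⟩
    simp only [pow_succ, ← sum_mul]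
    ring
  have hu : IsUnit (∑ i ∈ range p, s ^ i) :=
    (hcop.pow_right (n := k)).isUnit_of_dvd' dvd_rfl ⟨m, by rw [← h, mul_comm]⟩
  have := int_not_isUnit_geom_sum₂ h0 one_ne_zero (by omega) hp hp1
  simp only [one_pow, mul_one] at this
  exact this hu

/-! ### Unique roots and nonexistence of p-th roots. -/

namespace UniqueRootProperty

variable {G : Type*} [Group G]

theorem zpow_injective (hG : UniqueRootProperty G) {d : G} (hd : d ≠ 1) :
    Function.Injective fun n : ℤ => d ^ n := by
  rw [injective_zpow_iff_not_isOfFinOrder]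
  intro h
  obtain ⟨n, hn, h⟩ := isOfFinOrder_iff_pow_eq_one.1 h
  exact hd (hG d 1 n hn (by rw [h, one_pow]))

/-- The elements `τ * d` and `τ` have the same square. -/
theorem eq_one_of_conj_eq_inv (hG : UniqueRootProperty G) {τ d : G} (h : τ * d * τ⁻¹ = d⁻¹) :
    d = 1 := by
  have h1 : τ * d = d⁻¹ * τ := by rw [← h]; group
  have := hG (τ * d) τ 2 two_pos (by
    calc (τ * d) ^ 2 = τ * (d * (τ * d)) := by rw [pow_two, mul_assoc]
      _ = τ ^ 2 := by rw [h1, mul_inv_cancel_left, pow_two])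
  simpa using this

end UniqueRootProperty

section

variable {G : Type*} [Group G]

theorem pow_mul_zpow_of_conj_eq {τ d : G} {s : ℤ} (h : τ * d * τ⁻¹ = d ^ s) (k : ℕ) (m : ℤ) :
    τ ^ k * d ^ m = d ^ (s ^ k * m) * τ ^ k := by
  induction k with
  | zero => simp
  | succ k ih =>
    have h1 : ∀ n : ℤ, τ * d ^ n = d ^ (s * n) * τ := fun n => by
      rw [zpow_mul, ← h, conj_zpow]; group
    rw [pow_succ', mul_assoc, ih, ← mul_assoc, h1, pow_succ', mul_assoc, mul_assoc]

/-- Positive powers of `τ` move rightwards past powers of `d`, so a large enough power on the left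
clears the inverses of `τ`. -/
theorem exists_eq_of_mem_closure_of_conj_eq {τ d : G} {s : ℤ} (h : τ * d * τ⁻¹ = d ^ s) {w : G}
    (hw : w ∈ Subgroup.closure {τ, d}) :
    ∃ (k : ℕ) (m : ℤ) (j : ℕ), τ ^ k * w = d ^ m * τ ^ j := by
  have hd : ∀ (n : ℤ) (y : G), (∃ (k : ℕ) (m : ℤ) (j : ℕ), τ ^ k * y = d ^ m * τ ^ j) →
      ∃ (k : ℕ) (m : ℤ) (j : ℕ), τ ^ k * (d ^ n * y) = d ^ m * τ ^ j := by
    rintro n y ⟨k, m, j, e⟩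
    refine ⟨k, s ^ k * n + m, j, ?_⟩
    rw [← mul_assoc, pow_mul_zpow_of_conj_eq h, mul_assoc, e, zpow_add, mul_assoc]
  induction hw using Subgroup.closure_induction_left with
  | one => exact ⟨0, 0, 0, by simp⟩
  | mul_left x hx y _ ih =>
    rcases hx with rfl | rfl
    · obtain ⟨k, m, j, e⟩ := ih
      refine ⟨k, s * m, j + 1, ?_⟩
      rw [← mul_assoc, ← pow_succ, pow_succ', mul_assoc, e, ← mul_assoc]
      have := pow_mul_zpow_of_conj_eq h 1 m
      rw [pow_one, pow_one] at this
      rw [this, mul_assoc, ← pow_succ']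
    · simpa using hd 1 y ih
  | inv_mul_cancel x hx y _ ih =>
    rcases hx with rfl | rfl
    · obtain ⟨k, m, j, e⟩ := ih
      exact ⟨k + 1, m, j, by rw [pow_succ, mul_assoc, mul_inv_cancel_left, e]⟩
    · simpa using hd (-1) y ih

open Finset in
/-- In a solvable Baumslag–Solitar group with unique roots, `τ ^ p * d` has no `p`-th root. -/
theorem pow_ne_pow_mul_of_conj_eq (hG : UniqueRootProperty G) (σ : G →* Multiplicative ℤ)
    {τ d : G} (hτ : σ τ = Multiplicative.ofAdd 1) (hσd : σ d = 1) (hd : d ≠ 1) {s : ℤ}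
    (h : τ * d * τ⁻¹ = d ^ s) (hgen : Subgroup.closure {τ, d} = ⊤) {p : ℕ} (hp : Odd p)
    (hp1 : p ≠ 1) (u : G) : u ^ p ≠ τ ^ p * d := by
  intro hu
  obtain ⟨k, m, j, e⟩ := exists_eq_of_mem_closure_of_conj_eq h (hgen ▸ Subgroup.mem_top u)
  have hp0 : (p : ℤ) ≠ 0 := by exact_mod_cast hp.pos.ne'
  have hσu : (σ u).toAdd = 1 := by
    have := congrArg (fun w => (σ w).toAdd) hu
    simp only [map_mul, map_pow, hτ, hσd, mul_one, toAdd_pow, toAdd_ofAdd, nsmul_eq_mul] at this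
    exact mul_left_cancel₀ hp0 (by rw [this, mul_one])
  have hj : j = k + 1 := by
    have := congrArg (fun w => (σ w).toAdd) e
    simp only [map_mul, map_pow, map_zpow, hτ, hσd, one_zpow, one_mul, toAdd_pow, toAdd_ofAdd,
      nsmul_eq_mul, toAdd_mul, hσu] at this
    omega
  subst hj
  have hconj : τ ^ k * u * (τ ^ k)⁻¹ = d ^ m * τ := by
    rw [e, pow_succ']; group
  have hpow : ∀ n : ℕ, (d ^ m * τ) ^ n = d ^ (m * ∑ i ∈ range n, s ^ i) * τ ^ n := by
    intro n
    induction n with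
    | zero => simp
    | succ n ih =>
      rw [pow_succ, ih, mul_assoc, ← mul_assoc (τ ^ n), pow_mul_zpow_of_conj_eq h, sum_range_succ,
        mul_add, zpow_add, mul_comm (s ^ n) m, pow_succ]
      simp only [mul_assoc]
  -- Conjugating `u ^ p = τ ^ p * d` by `τ ^ k` and comparing exponents of `d` gives `m * ∑ s ^ i =
  -- s ^ (p + k)`.
  have key := hpow p
  have h1 := pow_mul_zpow_of_conj_eq h (k + p) 1
  rw [zpow_one, mul_one] at h1
  rw [← hconj, conj_pow, hu, ← mul_assoc, ← pow_add, h1, add_comm k p, pow_add τ p k, ← mul_assoc,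
    mul_inv_cancel_right, mul_left_inj] at key
  refine int_mul_geom_sum_ne_pow hp hp1 ?_ ?_ m (p + k) (hG.zpow_injective hd key.symm)
  · rintro rfl
    apply hd
    simpa using h
  · rintro rfl
    exact hd (hG.eq_one_of_conj_eq_inv (by simpa using h))

-- Here `(t * z) ^ p` is `t ^ p` times the product of the conjugates of `z` by powers of `t`. These
-- are powers of `c` whose exponents form a geometric progression, which would have to sum to 1.
open Finset in
theorem mul_pow_ne_pow_mul_of_conj_mem_zpowers (hG : UniqueRootProperty G) {t c z : G}
    (hc : c ≠ 1) {p : ℕ} (hp : Odd p) (hp1 : p ≠ 1)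
    (hz : ∀ i, i + 1 < p → (t ^ i)⁻¹ * z * t ^ i ∈ Subgroup.zpowers c) :
    (t * z) ^ p ≠ t ^ p * c := by
  intro h
  have hinj := hG.zpow_injective hc
  have hpos := hp.pos
  have step : ∀ (n : ℕ) (y : G), (t * z) ^ n = t ^ n * y →
      (t * z) ^ (n + 1) = t ^ (n + 1) * ((t ^ n)⁻¹ * z * t ^ n * y) := by
    intro n y hy
    rw [pow_succ', hy, pow_succ']; group
  have hmem : ∀ n, n < p → ∃ y ∈ Subgroup.zpowers c, (t * z) ^ n = t ^ n * y := by
    intro n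
    induction n with
    | zero => exact fun _ => ⟨1, one_mem _, by simp⟩
    | succ n ih =>
      intro hn
      obtain ⟨y, hy, e⟩ := ih (by omega)
      exact ⟨_, mul_mem (hz n hn) hy, step n y e⟩
  -- The hypothesis omits `i = p - 1`; that conjugate is solved for in the assumed root equation.
  -- Beyond the range the value 0 is arbitrary.
  have hz' : ∀ i, ∃ m : ℤ, i < p → c ^ m = (t ^ i)⁻¹ * z * t ^ i := by
    intro i
    by_cases hi : i + 1 < p
    · obtain ⟨m, hm⟩ := hz i hi
      exact ⟨m, fun _ => hm⟩
    by_cases hi' : i < p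
    · obtain ⟨y, hy, e⟩ := hmem i hi'
      have e' := step i y e
      rw [show i + 1 = p by omega, h, mul_right_inj] at e'
      obtain ⟨m, hm⟩ := mul_mem (Subgroup.mem_zpowers c) (inv_mem hy)
      refine ⟨m, fun _ => hm.trans ?_⟩
      rw [mul_inv_eq_iff_eq_mul]
      exact e'
    · exact ⟨0, fun h => absurd h hi'⟩
  choose m hm using hz'
  have hsum : ∀ n, n ≤ p → (t * z) ^ n = t ^ n * c ^ ∑ i ∈ range n, m i := by
    intro n
    induction n with
    | zero => simp
    | succ n ih =>
      intro hn
      rw [step n _ (ih (by omega)), ← hm n hn, ← zpow_add, sum_range_succ, add_comm (m n)]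
  have h0 : c ^ m 0 = z := by simpa using hm 0 hpos
  have h1 : c ^ m 1 = t⁻¹ * z * t := by simpa using hm 1 (by omega)
  have hz1 : z ≠ 1 := by
    rintro rfl
    apply hc
    simpa using h
  refine int_sum_ne_one_of_geometric hp hp1 m ?_ ?_ ?_ ?_ (hinj ?_)
  · intro e
    rw [e, zpow_zero] at h0
    exact hz1 h0.symm
  · intro e
    rw [e, zpow_zero, eq_comm, mul_assoc, inv_mul_eq_one, right_eq_mul] at h1
    exact hz1 h1
  · intro e
    refine hz1 (hG.eq_one_of_conj_eq_inv (τ := t⁻¹) ?_)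
    rw [inv_inv, ← h1, ← h0, ← zpow_neg]
    congr 1
    omega
  · intro i hi
    apply hinj
    have e : (t ^ (i + 1))⁻¹ * z * t ^ (i + 1) = t⁻¹ * ((t ^ i)⁻¹ * z * t ^ i) * t⁻¹⁻¹ := by
      rw [pow_succ]; group
    have e1 : t⁻¹ * z * t = t⁻¹ * z * t⁻¹⁻¹ := by group
    change c ^ _ = c ^ _
    rw [mul_comm (m 0), zpow_mul, zpow_mul, h1, hm _ hi, e, ← hm i (by omega), e1, conj_zpow,
      conj_zpow, ← h0, ← zpow_mul, ← zpow_mul, mul_comm]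
  · change c ^ _ = c ^ _
    rw [zpow_one]
    exact mul_left_cancel ((hsum p le_rfl).symm.trans h)

end

theorem UniqueRootProperty.of_mulEquiv {G Γ : Type*} [Group G] [Group Γ] (e : G ≃* Γ)
    (hG : UniqueRootProperty G) : UniqueRootProperty Γ := fun x y n hn h =>
  e.symm.injective (hG _ _ n hn (by rw [← map_pow, h, map_pow]))

/-! ### Excluding the image of t in HNN extensions. -/

namespace HNNExtension

variable {A : Type*} [Group A] {C D : Subgroup A} {φ : C ≃* D}

theorem mem_closure_t_of {x : A} (hx : Subgroup.zpowers x = ⊤) :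
    Subgroup.closure {t, of x} = (⊤ : Subgroup (HNNExtension A C D φ)) := by
  rw [eq_top_iff]
  intro w _
  induction w using induction_on with
  | of a =>
    obtain ⟨n, rfl⟩ : a ∈ Subgroup.zpowers x := hx ▸ Subgroup.mem_top a
    simp only [map_zpow]
    exact zpow_mem (Subgroup.subset_closure (by simp)) n
  | t => exact Subgroup.subset_closure (by simp)
  | mul v w hv hw => exact mul_mem (hv trivial) (hw trivial)
  | inv w hw => exact inv_mem (hw trivial)

theorem pow_ne_t_pow_mul_of_left_eq_top (hG : UniqueRootProperty (HNNExtension A C D φ))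
    (hC : C = ⊤) {x : A} (hx : Subgroup.zpowers x = C) (hx1 : x ≠ 1) {p : ℕ} (hp : Odd p)
    (hp1 : p ≠ 1) (u : HNNExtension A C D φ) : u ^ p ≠ t ^ p * of x := by
  have hxC : x ∈ C := hx ▸ Subgroup.mem_zpowers x
  obtain ⟨s, hs⟩ : (φ ⟨x, hxC⟩ : A) ∈ Subgroup.zpowers x := hx.trans hC ▸ Subgroup.mem_top _
  refine pow_ne_pow_mul_of_conj_eq hG (exponent φ (Multiplicative.ofAdd 1)) (exponent_t _)
    (exponent_of _ _) ?_ (s := s) ?_ (mem_closure_t_of (hx.trans hC)) hp hp1 u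
  · rwa [Ne, map_eq_one_iff _ (of_injective φ)]
  · rw [← map_zpow, ← equiv_eq_conj ⟨x, hxC⟩]
    exact congrArg of hs.symm

theorem pow_ne_t_pow_mul_of_right_eq_top (hG : UniqueRootProperty (HNNExtension A C D φ))
    (hD : D = ⊤) {x : A} (hx : Subgroup.zpowers x = C) (hx1 : x ≠ 1) {p : ℕ} (hp : Odd p)
    (hp1 : p ≠ 1) (u : HNNExtension A C D φ) : u ^ p ≠ t ^ p * of x := by
  intro hu
  have hxC : x ∈ C := hx ▸ Subgroup.mem_zpowers x
  obtain ⟨y, hy⟩ : ∃ y : A, φ ⟨x, hxC⟩ = y := ⟨_, rfl⟩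
  have hyt : (of y : HNNExtension A C D φ) = t * of x * t⁻¹ := by
    rw [← hy]; exact equiv_eq_conj (φ := φ) ⟨x, hxC⟩
  have hygen : Subgroup.zpowers y⁻¹ = ⊤ := by
    rw [Subgroup.zpowers_inv, eq_top_iff]
    intro a _
    obtain ⟨n, hn⟩ : (φ.symm ⟨a, hD ▸ Subgroup.mem_top a⟩ : A) ∈ Subgroup.zpowers x := by
      rw [hx]; exact Subtype.property _
    refine ⟨n, ?_⟩
    have : (⟨x, hxC⟩ : C) ^ n = φ.symm ⟨a, hD ▸ Subgroup.mem_top a⟩ := Subtype.ext hn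
    have := congrArg (fun c => (φ c : A)) this
    simpa [hy] using this
  obtain ⟨s, hs⟩ : x⁻¹ ∈ Subgroup.zpowers y⁻¹ := hygen ▸ Subgroup.mem_top _
  have hgen : Subgroup.closure {t⁻¹, of y⁻¹} = (⊤ : Subgroup (HNNExtension A C D φ)) := by
    rw [eq_top_iff, ← mem_closure_t_of hygen, Subgroup.closure_le]
    rintro w (rfl | rfl)
    · exact inv_mem_iff.1 (Subgroup.subset_closure (by simp))
    · exact Subgroup.subset_closure (by simp)
  -- Reversing `t` turns this into the ascending case: the inverse of `t ^ p * of x`, conjugated by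
  -- `t⁻¹ ^ (p - 1)`, is `t⁻¹ ^ p * of y⁻¹`.
  refine pow_ne_pow_mul_of_conj_eq hG (exponent φ (Multiplicative.ofAdd (-1))) (τ := t⁻¹)
    (d := of y⁻¹) (by rw [map_inv, exponent_t]; rfl) (exponent_of _ _) ?_ (s := s) ?_ hgen
    hp hp1 (t⁻¹ ^ (p - 1) * u⁻¹ * (t⁻¹ ^ (p - 1))⁻¹) ?_
  · rw [Ne, map_eq_one_iff _ (of_injective φ), inv_eq_one]
    intro h
    apply hx1
    have : φ ⟨x, hxC⟩ = 1 := Subtype.ext (hy.trans h)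
    rw [map_eq_one_iff _ φ.injective] at this
    exact congrArg Subtype.val this
  · rw [← map_zpow, show y⁻¹ ^ s = x⁻¹ from hs, map_inv, map_inv, hyt]
    group
  · rw [conj_pow, inv_pow u, hu, map_inv, hyt]
    obtain ⟨q, rfl⟩ : ∃ q, p = q + 1 := ⟨p - 1, by have := hp.pos; omega⟩
    rw [Nat.add_sub_cancel, pow_succ, pow_succ]
    group

/-- If `t * z` behaves like the image of `t` under an extension of the twist to the whole group,
then the conjugates of `z` by small powers of `t` belong to `C`. -/
theorem conj_mem_map_of_extends_twist (hC : C ≠ ⊤) (hD : D ≠ ⊤) {x : A} (hx : x ∈ C) {p : ℕ}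
    {u : HNNExtension A C D φ}
    (h1 : ∀ i, i + 1 < p → ∀ a, t * (t ^ i * of a * (t ^ i)⁻¹) * t⁻¹ =
      u * (t ^ i * of a * (t ^ i)⁻¹) * u⁻¹)
    (h2 : ∀ a, of a = u * ((t * of x)⁻¹ * of a * (t * of x)) * u⁻¹) :
    ∀ i, i + 1 < p → (t ^ i)⁻¹ * (t⁻¹ * u) * t ^ i ∈ C.map of := by
  have hbase : ∀ i, i + 1 < p → ∃ a, of a = (t ^ i)⁻¹ * (t⁻¹ * u) * t ^ i := by
    intro i hi
    refine mem_range_of_of_commute hC hD fun a => ?_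
    have := congrArg (fun w => (t ^ i)⁻¹ * t⁻¹ * w * u * t ^ i) (h1 i hi a)
    simp only [mul_assoc, inv_mul_cancel_left, inv_mul_cancel, mul_one]
      at this ⊢
    exact this.symm
  -- The twisted edge supplies one more element centralising the base; with `t⁻¹ * u` also in the
  -- base, the edge relation puts `t⁻¹ * u` in `C`.
  obtain ⟨b, hb⟩ : ∃ b, of b = u * (t * of x)⁻¹ := by
    refine mem_range_of_of_commute hC hD fun a => ?_
    have := congrArg (fun w => w * u * (t * of x)⁻¹) (h2 a)
    rw [← mul_assoc, this]
    group
  intro i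
  induction i with
  | zero =>
    intro hi
    obtain ⟨a, ha⟩ := hbase 0 hi
    rw [← ha]
    refine ⟨a, ?_, rfl⟩
    have : a * x⁻¹ ∈ C := by
      refine mem_of_t_mul_of_eq (φ := φ) (b := b) ?_
      rw [map_mul, ha, hb, map_inv]
      group
    exact (C.mul_mem_cancel_right (inv_mem hx)).1 this
  | succ i _ =>
    intro hi
    obtain ⟨a, ha⟩ := hbase i (by omega)
    obtain ⟨b, hb⟩ := hbase (i + 1) hi
    rw [← hb]
    -- Consecutive conjugates both lie in the base and differ by conjugation by `t`, so the later
    -- one lies in `C`.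
    refine ⟨b, mem_of_t_mul_of_eq (φ := φ) (b := a) ?_, rfl⟩
    rw [ha, hb, pow_succ]
    group

theorem index_ker_exponent (φ : C ≃* D) (n : ℕ) [NeZero n] :
    (exponent φ (Multiplicative.ofAdd (1 : ZMod n))).ker.index = n := by
  have hs : Function.Surjective (exponent φ (Multiplicative.ofAdd (1 : ZMod n))) := fun y =>
    ⟨t ^ y.toAdd.val, by
      rw [map_pow, exponent_t, ← ofAdd_nsmul, nsmul_one, ZMod.natCast_zmod_val, ofAdd_toAdd]⟩
  rw [Subgroup.index_ker, MonoidHom.range_eq_top.2 hs, Subgroup.card_top]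
  exact Nat.card_zmod n

end HNNExtension

/-! ### The main theorem. -/

open HNNExtension in
theorem mainTheorem7 {A G : Type*} [Group A] [Group G] (C D : Subgroup A) (φ : C ≃* D)
    (hCcyclic : IsCyclic C) (hCinfinite : Infinite C)
    (e : G ≃* HNNExtension A C D φ) (hG : UniqueRootProperty G) :
    ¬ Group.FG (Comm G) := by
  intro hfg
  obtain ⟨x, hx⟩ := (Subgroup.isCyclic_iff_exists_zpowers_eq_top C).1 hCcyclic
  have hx1 : x ≠ 1 := by
    rintro rfl
    rw [Subgroup.zpowers_one_eq_bot] at hx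
    subst hx
    exact not_finite (⊥ : Subgroup A)
  have hxC : x ∈ C := hx ▸ Subgroup.mem_zpowers x
  have hxcomm : ∀ y ∈ C, Commute x y := by
    intro y hy
    rw [← hx] at hy
    obtain ⟨n, rfl⟩ := hy
    exact Commute.self_zpow x n
  have hΓ := hG.of_mulEquiv e
  obtain ⟨N, hN⟩ := Comm.exists_root_of_fg e hG hfg
  -- The 3 makes `p` odd.
  obtain ⟨p, hlt, hp⟩ := Nat.exists_infinite_primes (N + 3)
  have hodd : Odd p := hp.odd_of_ne_two (by omega)
  have := NeZero.mk hp.ne_zero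
  have hq : orderOf (Multiplicative.ofAdd (1 : ZMod p)) = p := by
    rw [orderOf_ofAdd_eq_addOrderOf, ZMod.addOrderOf_one]
  set q := Multiplicative.ofAdd (1 : ZMod p)
  obtain ⟨u, hu1, hu2⟩ := hN p hp (by omega) (exponent φ q).ker inferInstance
    (index_ker_exponent φ p) (kerTwist q x hxcomm) t
  have hroot : u ^ p = t ^ p * of x := by
    rw [hu1 (by rw [MonoidHom.mem_ker, map_pow, exponent_t]; exact orderOf_dvd_iff_pow_eq_one.1 hq.dvd),
      coe_kerTwist]
    have := twist_t_pow_orderOf (φ := φ) q x hxcomm (by rw [hq]; exact hp.ne_zero)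
    rwa [hq] at this
  by_cases hC : C = ⊤
  · exact pow_ne_t_pow_mul_of_left_eq_top hΓ hC hx hx1 hodd hp.one_lt.ne' u hroot
  by_cases hD : D = ⊤
  · exact pow_ne_t_pow_mul_of_right_eq_top hΓ hD hx hx1 hodd hp.one_lt.ne' u hroot
  -- The twist fixes the conjugates of the base by `t ^ i` and `t ^ (i + 1)` since both exponents
  -- are below `p`; on the conjugate by `t⁻¹` it crosses the twisted edge.
  have hz := conj_mem_map_of_extends_twist hC hD hxC (p := p) (u := u) (fun i hi a => by
      have h := hu2 (t ^ i * of a * (t ^ i)⁻¹) (by simp [MonoidHom.mem_ker])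
        (by simp [MonoidHom.mem_ker])
      have e1 : t * (t ^ i * of a * (t ^ i)⁻¹) * t⁻¹ =
          (t ^ (i + 1) * of a * (t ^ (i + 1))⁻¹ : HNNExtension A C D φ) := by
        rw [pow_succ']; group
      rw [coe_kerTwist, coe_kerTwist, twist_conj_t_pow _ _ _ (by omega)] at h
      simp only [e1] at h ⊢
      rw [← h, twist_conj_t_pow _ _ _ (by omega)]) (fun a => by
      have h := hu2 (t⁻¹ * of a * t) (by simp [MonoidHom.mem_ker])
        (by simp [MonoidHom.mem_ker])
      have e1 : t * (t⁻¹ * of a * t) * t⁻¹ = (of a : HNNExtension A C D φ) := by group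
      rw [coe_kerTwist, coe_kerTwist, twist_conj_t_inv] at h
      simp only [e1] at h
      rwa [twist_of] at h)
  refine mul_pow_ne_pow_mul_of_conj_mem_zpowers hΓ (t := t) (c := of x) (z := t⁻¹ * u)
    (by rwa [Ne, map_eq_one_iff _ (of_injective φ)]) hodd hp.one_lt.ne' (fun i hi => ?_)
    (by rw [mul_inv_cancel_left, hroot])
  obtain ⟨y, hy, e⟩ := hz i hi
  obtain ⟨n, rfl⟩ : y ∈ Subgroup.zpowers x := hx ▸ hy
  exact ⟨n, by rw [← e]; exact (map_zpow of x n).symm⟩
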